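/- Let $G_I,G_{II},G_{III},G_{IV}\subset GL_2(\mathbb{C})$ be the groups $$G_I=\left\langle \tfrac{1}{\sqrt2}\begin{pmatrix}1&1\\1&-1\end{pmatrix},\begin{pmatrix}1&0\\0&-1\end{pmatrix}\right\rangle,\qquad G_{II}=\left\langle \tfrac{1}{\sqrt2}\begin{pmatrix}1&1\\1&-1\end{pmatrix},\begin{pmatrix}1&0\\0&i\end{pmatrix}\right\rangle,$$ $$G_{III}=\left\langle \tfrac{1}{\sqrt3}\begin{pmatrix}1&2\\1&-1\end{pmatrix},\begin{pmatrix}1&0\\0&e^{2\pi i/3}\end{pmatrix}\right\rangle,\qquad G_{IV}=\left\langle \tfrac12\begin{pmatrix}1&3\\1&-1\end{pmatrix},\begin{pmatrix}1&0\\0&-1\end{pmatrix}\right\rangle.$$ These groups are finite. For $G$ one of them and $k\ge 0$, the E-polynomial $\varphi_k=\varphi_k^{G}\in\mathbb{C}[x,y]$ is $$\varphi_k(x,y)=\frac{1}{|G|}\sum_{\sigma\in G}(\sigma_{11}x+\sigma_{12}y)^k,$$ where $(\sigma_{11},\sigma_{12})$ is the first row of $\sigma$. Let $\mathfrak{E}^{G}$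 be the $\mathbb{C}$-subalgebra of $\mathbb{C}[x,y]$ generated by all the $\varphi_k^{G}$, $k\ge 0$. Then $$\mathfrak{E}^{G_I}=\mathbb{C}[\varphi_2,\varphi_8],\qquad \mathfrak{E}^{G_{II}}=\mathbb{C}[\varphi_8,\varphi_{24}],\qquad \mathfrak{E}^{G_{III}}=\mathbb{C}[\varphi_4,\varphi_{12}],\qquad \mathfrak{E}^{G_{IV}}=\mathbb{C}[\varphi_2,\varphi_6],$$ where in each case the E-polynomials are those of the group in question, and the two generators are algebraically independent over $\mathbb{C}$, so that $\mathfrak{E}^{G}$ is a polynomial ring in them. -/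

import Mathlib

open MvPolynomial

noncomputable section

namespace EPoly

/-- `(1/√2) [[1, 1], [1, -1]]`. -/
def hadamard2 : GL (Fin 2) ℂ :=
  Matrix.GeneralLinearGroup.mkOfDetNeZero
    (((Real.sqrt 2 : ℝ) : ℂ)⁻¹ • !![1, 1; 1, -1]) (by
      rw [Matrix.det_smul, Matrix.det_fin_two_of]
      exact mul_ne_zero (pow_ne_zero _ (inv_ne_zero (by simp))) (by norm_num))

/-- `(1/√3) [[1, 2], [1, -1]]`. -/
def hadamard3 : GL (Fin 2) ℂ :=
  Matrix.GeneralLinearGroup.mkOfDetNeZero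
    (((Real.sqrt 3 : ℝ) : ℂ)⁻¹ • !![1, 2; 1, -1]) (by
      rw [Matrix.det_smul, Matrix.det_fin_two_of]
      exact mul_ne_zero (pow_ne_zero _ (inv_ne_zero (by simp))) (by norm_num))

/-- `(1/2) [[1, 3], [1, -1]]`. -/
def hadamard4 : GL (Fin 2) ℂ :=
  Matrix.GeneralLinearGroup.mkOfDetNeZero
    ((2 : ℂ)⁻¹ • !![1, 3; 1, -1]) (by
      rw [Matrix.det_smul, Matrix.det_fin_two_of]
      exact mul_ne_zero (pow_ne_zero _ (inv_ne_zero (by norm_num))) (by norm_num))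

/-- The diagonal matrix `[[1, 0], [0, c]]`, for `c ≠ 0`. -/
def diagOne (c : ℂ) (hc : c ≠ 0) : GL (Fin 2) ℂ :=
  Matrix.GeneralLinearGroup.mkOfDetNeZero !![1, 0; 0, c] (by
    rw [Matrix.det_fin_two_of]; simpa using hc)

/-- The group `G_I`. -/
def groupI : Subgroup (GL (Fin 2) ℂ) :=
  Subgroup.closure {hadamard2, diagOne (-1) (by norm_num)}

/-- The group `G_II`. -/
def groupII : Subgroup (GL (Fin 2) ℂ) :=
  Subgroup.closure {hadamard2, diagOne Complex.I Complex.I_ne_zero}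

/-- The group `G_III`. -/
def groupIII : Subgroup (GL (Fin 2) ℂ) :=
  Subgroup.closure
    {hadamard3, diagOne (Complex.exp (2 * Real.pi * Complex.I / 3)) (Complex.exp_ne_zero _)}

/-- The group `G_IV`. -/
def groupIV : Subgroup (GL (Fin 2) ℂ) :=
  Subgroup.closure {hadamard4, diagOne (-1) (by norm_num)}

/-- The linear form `σ₁ x̄ = σ₁₁ x + σ₁₂ y` given by the first row `σ₁` of `σ`,
with `x = X 0` and `y = X 1`. -/
def firstRowForm (σ : GL (Fin 2) ℂ) : MvPolynomial (Fin 2) ℂ :=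
  C ((σ : Matrix (Fin 2) (Fin 2) ℂ) 0 0) * X 0 + C ((σ : Matrix (Fin 2) (Fin 2) ℂ) 0 1) * X 1

/-- The E-polynomial `φ_k = (1/|G|) ∑_{σ ∈ G} (σ₁ x̄)^k` of a finite group `G`
of invertible `2 × 2` matrices. -/
def ePoly (G : Subgroup (GL (Fin 2) ℂ)) (k : ℕ) : MvPolynomial (Fin 2) ℂ :=
  C ((Nat.card G : ℂ)⁻¹) * ∑ᶠ σ : G, firstRowForm (σ : GL (Fin 2) ℂ) ^ k

/-- The ring of E-polynomials of `G`: the `ℂ`-subalgebra of `ℂ[x, y]` generated by all of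
the E-polynomials of `G`. -/
def ePolyRing (G : Subgroup (GL (Fin 2) ℂ)) : Subalgebra ℂ (MvPolynomial (Fin 2) ℂ) :=
  Algebra.adjoin ℂ (Set.range (ePoly G))

/-- The ring of E-polynomials of `G` is the polynomial ring `ℂ[φ_a, φ_b]`: it is generated over
`ℂ` by `φ_a` and `φ_b`, which are algebraically independent over `ℂ`. -/
def EPolyRingIsPolynomialRing (G : Subgroup (GL (Fin 2) ℂ)) (a b : ℕ) : Prop :=
  ePolyRing G = Algebra.adjoin ℂ {ePoly G a, ePoly G b} ∧
    AlgebraicIndependent ℂ ![ePoly G a, ePoly G b]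

end EPoly

end

/-! The first row of σ is (1, 0)σ, so φ_k is the average of the k-th powers of the linear forms in
the orbit of (1, 0). In each case this orbit is a short list of forms ℓ_i times all d-th roots of
unity, with d = 2, 8, 4, 2 and 4, 6, 4, 3 forms respectively. Hence φ_k = 0 unless d ∣ k
(`ePoly_eq_zero`), and φ_{dm} is, up to a nonzero constant, the m-th power sum p_m of b_i = κ ℓ_i^d
(`card_mul_ePoly`).

By Newton's identities it is enough to write every elementary symmetric function e_j of the b_i as a
polynomial in p_1 and p_c, where c = 4, 3, 3, 3. Since G permutes the b_i, each e_j is an invariant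
of degree dj. There are few such invariants, and the relations needed are explicit identities in x
and y (`esymm_mem_groupI` to `esymm_mem_groupIV`); e_c itself comes from p_c by Newton.

Independence needs no Jacobian: each b_i is a root of ∏ (T - b_j), so the ℓ_i, and with them x and
y, are integral over ℂ[φ_d, φ_{dc}]. As ℂ[x, y] has transcendence degree 2, the two generators are
independent (`ePolyRingIsPolynomialRing`). -/

namespace EPoly

/-! ### Newton's identities and integrality -/

section SymmetricFunctions

variable {R A ι : Type*} [CommRing R] [CommRing A] [Algebra R A] [Fintype ι]

/-- Power sums lie in every subalgebra containing the elementary symmetric functions. -/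
theorem sum_pow_mem_of_esymm_mem (S : Subalgebra R A) (b : ι → A) (m : ℕ)
    (h : ∀ j ≤ m, (Finset.univ.val.map b).esymm j ∈ S) : ∑ i, b i ^ m ∈ S := by
  induction m using Nat.strong_induction_on with
  | _ m ih =>
    rcases Nat.eq_zero_or_pos m with rfl | hm
    · simp
    have key := congrArg (aeval b) (psum_eq_mul_esymm_sub_sum ι R m hm)
    simp only [psum, map_sum, map_sub, map_mul, map_pow, map_neg, map_one, map_natCast, aeval_X,
      aeval_esymm_eq_multiset_esymm] at key
    rw [key]
    refine sub_mem (mul_mem (mul_mem (pow_mem (neg_mem (one_mem _)) _) (natCast_mem S _))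
      (h m le_rfl)) (sum_mem fun a ha => ?_)
    obtain ⟨ha, ha'⟩ := Finset.mem_filter.mp ha
    have ha := Finset.HasAntidiagonal.mem_antidiagonal.mp ha
    obtain ⟨h1, h2⟩ := Set.mem_Ioo.mp ha'
    exact mul_mem (mul_mem (pow_mem (neg_mem (one_mem _)) _) (h _ (by lia)))
      (ih _ (by lia) fun j hj => h j (by lia))

/-- The `m`-th elementary symmetric function is a polynomial in the previous ones and
the `m`-th power sum, over a field of characteristic zero. -/
theorem esymm_mem_of_sum_pow_mem {K : Type*} [Field K] [CharZero K] [Algebra K A]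
    (S : Subalgebra K A) (b : ι → A) (m : ℕ) (hm : 0 < m)
    (h : ∀ j < m, (Finset.univ.val.map b).esymm j ∈ S) (hp : ∑ i, b i ^ m ∈ S) :
    (Finset.univ.val.map b).esymm m ∈ S := by
  have key := congrArg (aeval b) (mul_esymm_eq_sum ι K m)
  simp only [psum, map_sum, map_mul, map_pow, map_neg, map_one, map_natCast, aeval_X,
    aeval_esymm_eq_multiset_esymm] at key
  have hmem : (m : A) * (Finset.univ.val.map b).esymm m ∈ S := by
    rw [key]
    refine mul_mem (pow_mem (neg_mem (one_mem _)) _) (sum_mem fun a ha => ?_)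
    obtain ⟨ha, ha'⟩ := Finset.mem_filter.mp ha
    have ha := Finset.HasAntidiagonal.mem_antidiagonal.mp ha
    refine mul_mem (mul_mem (pow_mem (neg_mem (one_mem _)) _) (h _ ha')) ?_
    -- The term with index 0 carries p_m, the hypothesis `hp`; the others carry lower power sums.
    rcases Nat.eq_zero_or_pos a.1 with h0 | h0
    · rwa [show a.2 = m by lia]
    · exact sum_pow_mem_of_esymm_mem S b _ fun j hj => h j (by lia)
  have hm' : (m : K) ≠ 0 := Nat.cast_ne_zero.mpr hm.ne'
  have := S.smul_mem hmem (m : K)⁻¹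
  rwa [← nsmul_eq_mul, ← Nat.cast_smul_eq_nsmul K, smul_smul, inv_mul_cancel₀ hm', one_smul] at this

/-- Elements are integral over every subalgebra containing their elementary symmetric
functions. -/
theorem isIntegral_of_esymm_mem (S : Subalgebra R A) (b : ι → A)
    (h : ∀ j, (Finset.univ.val.map b).esymm j ∈ S) (i : ι) : IsIntegral S (b i) := by
  set s : Multiset A := Finset.univ.val.map b
  -- `b i` is a root of the monic ∏ (T - b_j), whose coefficients are ± the e_j and so lift to S.
  set P : Polynomial A := (s.map fun t => Polynomial.X - Polynomial.C t).prod with hP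
  have hmonic : P.Monic := Polynomial.monic_multiset_prod_of_monic _ _
    fun t _ => Polynomial.monic_X_sub_C t
  have hlift : P ∈ Polynomial.lifts (algebraMap S A) := by
    rw [hP, Multiset.prod_X_sub_X_eq_sum_esymm]
    refine sum_mem fun j _ => mul_mem (pow_mem ?_ _) (mul_mem ?_ ?_)
    · exact ⟨-1, by simp⟩
    · exact Polynomial.C'_mem_lifts ⟨⟨_, h j⟩, rfl⟩
    · exact Polynomial.X_pow_mem_lifts _ _
  obtain ⟨Q, hQ, -, hQm⟩ := Polynomial.lifts_and_natDegree_eq_and_monic hlift hmonic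
  refine ⟨Q, hQm, ?_⟩
  rw [← Polynomial.eval_map, hQ, hP, Polynomial.eval_multiset_prod]
  refine Multiset.prod_eq_zero ?_
  rw [Multiset.map_map, Multiset.mem_map]
  exact ⟨b i, Multiset.mem_map_of_mem b (Finset.mem_univ_val i), by simp⟩

theorem esymm_cons_succ (a : A) (s : Multiset A) (k : ℕ) :
    (a ::ₘ s).esymm (k + 1) = s.esymm (k + 1) + a * s.esymm k := by
  simp [Multiset.esymm, Multiset.powersetCard_cons, Multiset.map_map,
    Multiset.sum_map_mul_left]

theorem esymm_zero_right (s : Multiset A) : s.esymm 0 = 1 := by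
  simp [Multiset.esymm]

theorem esymm_eq_zero_of_card_lt (s : Multiset A) {k : ℕ} (h : s.card < k) : s.esymm k = 0 := by
  simp [Multiset.esymm, Multiset.powersetCard_eq_empty _ h]

theorem esymm_empty_succ (k : ℕ) : (0 : Multiset A).esymm (k + 1) = 0 :=
  esymm_eq_zero_of_card_lt _ (by simp)

end SymmetricFunctions

/-! ### Orbits of lines and the general criterion -/

section LineConfigurations

open Matrix

/-- The linear form `v₀ x + v₁ y`. -/
noncomputable def linForm (v : Fin 2 → ℂ) : MvPolynomial (Fin 2) ℂ :=
  C (v 0) * X 0 + C (v 1) * X 1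

theorem linForm_smul (c : ℂ) (v : Fin 2 → ℂ) : linForm (c • v) = C c * linForm v := by
  simp only [linForm, Pi.smul_apply, smul_eq_mul, map_mul]; ring

theorem firstRowForm_eq_linForm (σ : GL (Fin 2) ℂ) :
    firstRowForm σ = linForm (![1, 0] ᵥ* (σ : Matrix (Fin 2) (Fin 2) ℂ)) := by
  simp [firstRowForm, linForm, Matrix.vecMul, dotProduct]

/-- The row vectors `L i` represent, up to `d`-th roots of unity, the orbit of `L i₀ = (1, 0)`
under right multiplication by `G`, and this orbit is stable under the `d`-th roots of unity. -/
structure IsLineOrbit {ι : Type*} (G : Subgroup (GL (Fin 2) ℂ)) (d : ℕ)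
    (L : ι → Fin 2 → ℂ) (i₀ : ι) : Prop where
  base : L i₀ = ![1, 0]
  exists_ne : ∃ i, L i 1 ≠ 0
  permutes : ∀ σ ∈ G, ∃ π : Equiv.Perm ι, ∀ i, ∃ c : ℂ, c ^ d = 1 ∧
    L i ᵥ* (σ : Matrix (Fin 2) (Fin 2) ℂ) = c • L (π i)
  transitive : ∀ i, ∃ σ ∈ G, ∃ c : ℂ, c ^ d = 1 ∧
    L i₀ ᵥ* (σ : Matrix (Fin 2) (Fin 2) ℂ) = c • L i
  scalar : ∃ σ ∈ G, ∃ ζ : ℂ, IsPrimitiveRoot ζ d ∧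
    L i₀ ᵥ* (σ : Matrix (Fin 2) (Fin 2) ℂ) = ζ • L i₀

/-- It suffices to check that generators permute the lines. -/
theorem exists_perm_of_closure {ι : Type*} {T : Set (GL (Fin 2) ℂ)} {d : ℕ}
    {L : ι → Fin 2 → ℂ} (hd : 0 < d)
    (h : ∀ σ ∈ T, ∃ π : Equiv.Perm ι, ∀ i, ∃ c : ℂ, c ^ d = 1 ∧
      L i ᵥ* (σ : Matrix (Fin 2) (Fin 2) ℂ) = c • L (π i))
    (σ : GL (Fin 2) ℂ) (hσ : σ ∈ Subgroup.closure T) :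
    ∃ π : Equiv.Perm ι, ∀ i, ∃ c : ℂ, c ^ d = 1 ∧
      L i ᵥ* (σ : Matrix (Fin 2) (Fin 2) ℂ) = c • L (π i) := by
  induction hσ using Subgroup.closure_induction with
  | mem σ hσ => exact h σ hσ
  | one => exact ⟨1, fun i => ⟨1, one_pow _, by simp⟩⟩
  | mul σ τ _ _ hσ hτ =>
    obtain ⟨π, hπ⟩ := hσ
    obtain ⟨ρ, hρ⟩ := hτ
    refine ⟨π.trans ρ, fun i => ?_⟩
    obtain ⟨c, hc, e⟩ := hπ i
    obtain ⟨c', hc', e'⟩ := hρ (π i)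
    refine ⟨c * c', by rw [mul_pow, hc, hc', one_mul], ?_⟩
    rw [Units.val_mul, ← vecMul_vecMul, e, smul_vecMul, e', smul_smul, Equiv.trans_apply]
  | inv σ _ hσ =>
    obtain ⟨π, hπ⟩ := hσ
    refine ⟨π.symm, fun i => ?_⟩
    obtain ⟨c, hc, e⟩ := hπ (π.symm i)
    rw [Equiv.apply_symm_apply] at e
    refine ⟨c⁻¹, by rw [inv_pow, hc, inv_one], ?_⟩
    have h0 : c ≠ 0 := by
      rintro rfl
      rw [zero_pow hd.ne'] at hc
      exact zero_ne_one hc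
    have e2 : L i = c⁻¹ • (L (π.symm i) ᵥ* (σ : Matrix (Fin 2) (Fin 2) ℂ)) := by
      rw [e, smul_smul, inv_mul_cancel₀ h0, one_smul]
    rw [e2, smul_vecMul, vecMul_vecMul, ← Units.val_mul, mul_inv_cancel, Units.val_one, vecMul_one]

namespace IsLineOrbit

variable {ι : Type*} {G : Subgroup (GL (Fin 2) ℂ)} {d : ℕ} {L : ι → Fin 2 → ℂ} {i₀ : ι}

theorem finite [Finite ι] (h : IsLineOrbit G d L i₀) (hd : 0 < d) : Finite G := by
  have hroots : {c : ℂ | c ^ d = 1}.Finite :=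
    (Polynomial.nthRootsFinset d (1 : ℂ)).finite_toSet.subset fun c hc => by
      simpa [Polynomial.mem_nthRootsFinset hd] using hc
  let O : Set (Fin 2 → ℂ) := Set.image2 (fun (c : ℂ) i => c • L i) {c : ℂ | c ^ d = 1} Set.univ
  have hfin : O.Finite :=
    hroots.image2 _ Set.finite_univ
  have hpi := Set.Finite.pi' fun _ : ι => hfin
  let F : G → ι → Fin 2 → ℂ := fun σ i => L i ᵥ* ((σ : GL (Fin 2) ℂ) : Matrix (Fin 2) (Fin 2) ℂ)
  -- The image of (1, 0) is the first row of σ; the image of a line with nonzero second coordinate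
  -- then determines the second row.
  have hF : Function.Injective F := by
    intro σ τ e
    have e0 := congrFun e i₀
    obtain ⟨i₁, h1⟩ := h.exists_ne
    have e1 := congrFun e i₁
    simp only [F, h.base] at e0
    simp only [F] at e1
    apply Subtype.ext
    apply Units.ext
    have r0 : ∀ j, ((σ : GL (Fin 2) ℂ) : Matrix (Fin 2) (Fin 2) ℂ) 0 j
        = ((τ : GL (Fin 2) ℂ) : Matrix (Fin 2) (Fin 2) ℂ) 0 j := fun j => by
      simpa [vecMul, dotProduct] using congrFun e0 j
    ext i j
    fin_cases i
    · exact r0 j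
    · have := congrFun e1 j
      simp only [vecMul, dotProduct, Fin.sum_univ_two, r0 j, add_right_inj] at this
      exact mul_left_cancel₀ h1 this
  have := hpi.to_subtype
  refine Finite.of_injective (β := {f : ι → Fin 2 → ℂ | ∀ i, f i ∈ O})
    (fun σ => ⟨F σ, fun i => ?_⟩) fun σ τ e => hF (congrArg Subtype.val e)
  obtain ⟨π, hπ⟩ := h.permutes σ σ.2
  obtain ⟨c, hc, e⟩ := hπ i
  exact ⟨c, hc, π i, trivial, e.symm⟩

/-- The sum of the `k`-th powers of the linear forms in the orbit of `v`. -/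
noncomputable def orbitSum (G : Subgroup (GL (Fin 2) ℂ)) [Fintype G] (k : ℕ) (v : Fin 2 → ℂ) :
    MvPolynomial (Fin 2) ℂ :=
  ∑ σ : G, linForm (v ᵥ* ((σ : GL (Fin 2) ℂ) : Matrix (Fin 2) (Fin 2) ℂ)) ^ k

theorem orbitSum_vecMul [Fintype G] (k : ℕ) (v : Fin 2 → ℂ) (τ : GL (Fin 2) ℂ) (hτ : τ ∈ G) :
    orbitSum G k (v ᵥ* (τ : Matrix (Fin 2) (Fin 2) ℂ)) = orbitSum G k v := by
  unfold orbitSum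
  exact Fintype.sum_equiv (Equiv.mulLeft (⟨τ, hτ⟩ : G)) _ _ fun σ => by simp [vecMul_vecMul]

theorem orbitSum_smul [Fintype G] (k : ℕ) (c : ℂ) (v : Fin 2 → ℂ) :
    orbitSum G k (c • v) = C (c ^ k) * orbitSum G k v := by
  simp [orbitSum, smul_vecMul, linForm_smul, mul_pow, Finset.mul_sum]

theorem ePoly_eq_orbitSum [Fintype G] (k : ℕ) :
    ePoly G k = C ((Fintype.card G : ℂ)⁻¹) * orbitSum G k ![1, 0] := by
  simp only [ePoly, orbitSum, Nat.card_eq_fintype_card, finsum_eq_sum_of_fintype,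
    firstRowForm_eq_linForm]

/-- Some σ ∈ G scales (1, 0) by a primitive d-th root ζ. This multiplies the orbit sum by ζ^k, yet
the orbit sum is invariant under G. -/
theorem ePoly_eq_zero [Fintype G] (h : IsLineOrbit G d L i₀) {k : ℕ} (hk : ¬ d ∣ k) :
    ePoly G k = 0 := by
  obtain ⟨σ, hσ, ζ, hζ, e⟩ := h.scalar
  have key := orbitSum_vecMul k (L i₀) σ hσ
  rw [e, orbitSum_smul] at key
  have h1 : ζ ^ k - 1 ≠ 0 := sub_ne_zero.mpr fun h1 => hk (hζ.dvd_of_pow_eq_one k h1)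
  have h2 : C (ζ ^ k - 1) * orbitSum G k (L i₀) = 0 := by
    rw [map_sub, map_one]; linear_combination key
  rw [ePoly_eq_orbitSum, ← h.base]
  rcases mul_eq_zero.mp h2 with h3 | h3
  · exact absurd (C_eq_zero.mp h3) h1
  · rw [h3, mul_zero]

/-- Double counting of the sum over all pairs (i, σ): by transitivity each i contributes the orbit
sum of (1, 0), while each σ only permutes the d-th powers of the lines. -/
theorem card_mul_ePoly [Fintype G] [Fintype ι] (h : IsLineOrbit G d L i₀) (m : ℕ) :
    C (Fintype.card ι : ℂ) * ePoly G (d * m) = ∑ i, (linForm (L i) ^ d) ^ m := by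
  have h1 : ∀ i, orbitSum G (d * m) (L i) = orbitSum G (d * m) ![1, 0] := fun i => by
    obtain ⟨σ, hσ, c, hc, e⟩ := h.transitive i
    rw [← h.base, ← orbitSum_vecMul _ (L i₀) σ hσ, e, orbitSum_smul, pow_mul, hc, one_pow, map_one,
      one_mul]
  have h2 : ∑ i, orbitSum G (d * m) (L i)
      = Fintype.card G • ∑ i, (linForm (L i) ^ d) ^ m := by
    unfold orbitSum
    rw [Finset.sum_comm, ← Finset.card_univ, ← Finset.sum_const]
    refine Finset.sum_congr rfl fun σ _ => ?_
    obtain ⟨π, hπ⟩ := h.permutes σ σ.2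
    rw [← Equiv.sum_comp π fun i => (linForm (L i) ^ d) ^ m]
    refine Finset.sum_congr rfl fun i _ => ?_
    obtain ⟨c, hc, e⟩ := hπ i
    rw [e, linForm_smul, pow_mul, mul_pow, ← map_pow, hc, map_one, one_mul]
  rw [Finset.sum_congr rfl fun i _ => h1 i, Finset.sum_const, Finset.card_univ] at h2
  have h0 : (Fintype.card G : ℂ) ≠ 0 := Nat.cast_ne_zero.mpr Fintype.card_ne_zero
  rw [ePoly_eq_orbitSum, mul_left_comm, map_natCast C, ← nsmul_eq_mul, h2, nsmul_eq_mul, ← mul_assoc,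
    ← map_natCast C (Fintype.card G), ← map_mul, inv_mul_cancel₀ h0, map_one, one_mul]

/-- `φ_d` and `φ_{dc}` generate the ring of E-polynomials
as soon as the elementary symmetric functions of the `d`-th powers of the lines are
polynomials in the first and `c`-th power sums. -/
theorem ePolyRingIsPolynomialRing [Fintype ι] (h : IsLineOrbit G d L i₀) (hd : 0 < d)
    (c : ℕ) (κ : ℂ) (hκ : κ ≠ 0) (b : ι → MvPolynomial (Fin 2) ℂ)
    (hb : ∀ i, b i = C κ * linForm (L i) ^ d)
    (hS : ∀ S : Subalgebra ℂ (MvPolynomial (Fin 2) ℂ), ∑ i, b i ∈ S → ∑ i, b i ^ c ∈ S →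
      ∀ j, (Finset.univ.val.map b).esymm j ∈ S) :
    Finite G ∧ EPolyRingIsPolynomialRing G d (d * c) := by
  have hfin := h.finite hd
  refine ⟨hfin, ?_⟩
  have := Fintype.ofFinite G
  set S := Algebra.adjoin ℂ {ePoly G d, ePoly G (d * c)} with hSdef
  have hι : (Fintype.card ι : ℂ) ≠ 0 :=
    Nat.cast_ne_zero.mpr (Fintype.card_pos_iff.mpr ⟨i₀⟩).ne'
  have hC : ∀ a : ℂ, C a ∈ S := fun a => S.algebraMap_mem a
  have hbsum : ∀ m, ∑ i, b i ^ m = C (κ ^ m * Fintype.card ι) * ePoly G (d * m) := fun m => by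
    rw [map_mul, mul_assoc, h.card_mul_ePoly, Finset.mul_sum]
    exact Finset.sum_congr rfl fun i _ => by rw [hb, mul_pow, map_pow]
  have hesymm : ∀ j, (Finset.univ.val.map b).esymm j ∈ S := by
    apply hS
    · have := hbsum 1
      simp only [pow_one, mul_one] at this
      rw [this]
      exact mul_mem (hC _) (Algebra.subset_adjoin (by simp))
    · rw [hbsum]
      exact mul_mem (hC _) (Algebra.subset_adjoin (by simp))
  constructor
  · apply le_antisymm
    · refine Algebra.adjoin_le ?_
      rintro _ ⟨k, rfl⟩
      by_cases hk : d ∣ k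
      · obtain ⟨m, rfl⟩ := hk
        have h1 : κ ^ m * Fintype.card ι ≠ 0 := mul_ne_zero (pow_ne_zero _ hκ) hι
        have h2 : ePoly G (d * m) = C (κ ^ m * Fintype.card ι)⁻¹ * ∑ i, b i ^ m := by
          rw [hbsum, ← mul_assoc, ← map_mul, inv_mul_cancel₀ h1, map_one, one_mul]
        rw [h2]
        exact mul_mem (hC _) (sum_pow_mem_of_esymm_mem S b m fun j _ => hesymm j)
      · rw [h.ePoly_eq_zero hk]
        exact zero_mem S
    · refine Algebra.adjoin_mono ?_
      rintro _ (rfl | rfl)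
      · exact ⟨_, rfl⟩
      · exact ⟨_, rfl⟩
  · have hCint : ∀ a : ℂ, IsIntegral S (C a : MvPolynomial (Fin 2) ℂ) := fun a =>
      isIntegral_algebraMap (x := (⟨C a, hC a⟩ : S))
    have hlin : ∀ i, IsIntegral S (linForm (L i)) := fun i => by
      refine IsIntegral.of_pow hd ?_
      have h1 : linForm (L i) ^ d = C κ⁻¹ * b i := by
        rw [hb, ← mul_assoc, ← map_mul, inv_mul_cancel₀ hκ, map_one, one_mul]
      rw [h1]
      exact (hCint _).mul (isIntegral_of_esymm_mem S b hesymm i)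
    have hx : IsIntegral S (X 0 : MvPolynomial (Fin 2) ℂ) := by
      simpa [linForm, h.base] using hlin i₀
    have hy : IsIntegral S (X 1 : MvPolynomial (Fin 2) ℂ) := by
      obtain ⟨i, hi⟩ := h.exists_ne
      have h1 : (X 1 : MvPolynomial (Fin 2) ℂ)
          = C (L i 1)⁻¹ * (linForm (L i) - C (L i 0) * X 0) := by
        rw [linForm, add_sub_cancel_left, ← mul_assoc, ← map_mul, inv_mul_cancel₀ hi, map_one,
          one_mul]
      rw [h1]
      exact (hCint _).mul ((hlin i).sub ((hCint _).mul hx))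
    have hrange : Set.range ![ePoly G d, ePoly G (d * c)] = {ePoly G d, ePoly G (d * c)} := by
      simp [Matrix.range_cons, Matrix.range_empty, Set.pair_comm]
    have hint : Algebra.IsIntegral S (MvPolynomial (Fin 2) ℂ) := by
      refine ⟨fun p => ?_⟩
      induction p using MvPolynomial.induction_on with
      | C a => exact hCint a
      | add p q hp hq => exact hp.add hq
      | mul_X p i hp => fin_cases i; exacts [hp.mul hx, hp.mul hy]
    have halg : Algebra.IsAlgebraic S (MvPolynomial (Fin 2) ℂ) := hint.isAlgebraic
    rw [hSdef, ← hrange] at halg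
    exact (Algebra.IsAlgebraic.isTranscendenceBasis_of_le_trdeg_of_finite ℂ _
      (by simp)).1

end IsLineOrbit

end LineConfigurations

/-! ### Expanding elementary symmetric functions -/

section SymmetricFunctions

variable {A : Type*} [CommRing A]

/-- Peeling off two entries at a time brings in only their sum and product, which for conjugate
lines are free of the root of unity. -/
theorem esymm_cons_cons (a b : A) (s : Multiset A) (k : ℕ) :
    (a ::ₘ b ::ₘ s).esymm (k + 2) =
      s.esymm (k + 2) + (a + b) * s.esymm (k + 1) + a * b * s.esymm k := by
  rw [esymm_cons_succ, esymm_cons_succ, esymm_cons_succ]; ring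

theorem esymm_cons_cons_one (a b : A) (s : Multiset A) :
    (a ::ₘ b ::ₘ s).esymm 1 = s.esymm 1 + (a + b) := by
  rw [← zero_add 1, esymm_cons_succ, esymm_cons_succ, esymm_zero_right, esymm_zero_right]; ring

theorem esymm_singleton_one (a : A) : (a ::ₘ 0).esymm 1 = a := by
  rw [← zero_add 1, esymm_cons_succ, esymm_empty_succ, esymm_zero_right]; ring

theorem esymm_singleton_two (a : A) : (a ::ₘ 0).esymm 2 = 0 :=
  esymm_eq_zero_of_card_lt _ (by simp)

theorem esymm_one_eq_sum {ι : Type*} [Fintype ι] (b : ι → A) :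
    (Finset.univ.val.map b).esymm 1 = ∑ i, b i := by
  simp [Multiset.esymm, Multiset.powersetCard_one, Multiset.map_map]

theorem mem_of_ofNat_mul_mem [Algebra ℂ A] (S : Subalgebra ℂ A) (n : ℕ) [n.AtLeastTwo] {z : A}
    (h : (OfNat.ofNat n : A) * z ∈ S) : z ∈ S := by
  have h1 := S.smul_mem h (OfNat.ofNat n : ℂ)⁻¹
  have h2 : (OfNat.ofNat n : A) * z = (OfNat.ofNat n : ℂ) • z := by
    rw [Algebra.smul_def, map_ofNat]
  rwa [h2, smul_smul, inv_mul_cancel₀ (OfNat.ofNat_ne_zero n), one_smul] at h1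

variable [Algebra ℂ A] (S : Subalgebra ℂ A)

end SymmetricFunctions

/-! ### Action of the generators on row vectors -/

open Matrix

theorem isPrimitiveRoot_two_pow_of_pow_eq_neg_one {ζ : ℂ} {n : ℕ} (h : ζ ^ 2 ^ n = -1) :
    IsPrimitiveRoot ζ (2 ^ (n + 1)) := by
  have : Fact (Nat.Prime 2) := ⟨Nat.prime_two⟩
  rw [← orderOf_eq_prime_pow (x := ζ) (p := 2) (n := n)]
  · exact IsPrimitiveRoot.orderOf ζ
  · rw [h]; norm_num
  · rw [pow_succ, pow_mul, h]; norm_num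

theorem vecMul_hadamard2 (v : Fin 2 → ℂ) :
    v ᵥ* (hadamard2 : Matrix (Fin 2) (Fin 2) ℂ) =
      ![((Real.sqrt 2 : ℝ) : ℂ)⁻¹ * (v 0 + v 1), ((Real.sqrt 2 : ℝ) : ℂ)⁻¹ * (v 0 - v 1)] := by
  ext j
  fin_cases j <;> simp [hadamard2, Matrix.vecMul, dotProduct, GeneralLinearGroup.mkOfDetNeZero] <;>
    ring

theorem vecMul_hadamard3 (v : Fin 2 → ℂ) :
    v ᵥ* (hadamard3 : Matrix (Fin 2) (Fin 2) ℂ) =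
      ![((Real.sqrt 3 : ℝ) : ℂ)⁻¹ * (v 0 + v 1), ((Real.sqrt 3 : ℝ) : ℂ)⁻¹ * (2 * v 0 - v 1)] := by
  ext j
  fin_cases j <;> simp [hadamard3, Matrix.vecMul, dotProduct, GeneralLinearGroup.mkOfDetNeZero] <;>
    ring

theorem vecMul_hadamard4 (v : Fin 2 → ℂ) :
    v ᵥ* (hadamard4 : Matrix (Fin 2) (Fin 2) ℂ) =
      ![2⁻¹ * (v 0 + v 1), 2⁻¹ * (3 * v 0 - v 1)] := by
  ext j
  fin_cases j <;> simp [hadamard4, Matrix.vecMul, dotProduct, GeneralLinearGroup.mkOfDetNeZero] <;>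
    ring

theorem vecMul_diagOne (c : ℂ) (hc : c ≠ 0) (v : Fin 2 → ℂ) :
    v ᵥ* (diagOne c hc : Matrix (Fin 2) (Fin 2) ℂ) = ![v 0, c * v 1] := by
  ext j
  fin_cases j <;>
    simp [diagOne, Matrix.vecMul, dotProduct, GeneralLinearGroup.mkOfDetNeZero, mul_comm]

theorem inv_sqrt_ofNat_sq (n : ℕ) [n.AtLeastTwo] :
    OfNat.ofNat n * (((Real.sqrt (OfNat.ofNat n) : ℝ) : ℂ)⁻¹) ^ 2 = 1 := by
  rw [inv_pow, ← Complex.ofReal_pow, Real.sq_sqrt (Nat.ofNat_nonneg n), Complex.ofReal_ofNat]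
  exact mul_inv_cancel₀ (OfNat.ofNat_ne_zero n)

/-! ### The group G_I -/

section SymmetricFunctions

variable {A : Type*} [CommRing A] [Algebra ℂ A] (S : Subalgebra ℂ A)

/-- The squares of the lines of `G_I`. -/
theorem esymm_mem_groupI (x y : A) (b : Fin 4 → A)
    (hb : b = ![2 * x ^ 2, 2 * y ^ 2, (x + y) ^ 2, (x - y) ^ 2])
    (h1 : ∑ i, b i ∈ S) (h4 : ∑ i, b i ^ 4 ∈ S) (j : ℕ) :
    (Finset.univ.val.map b).esymm j ∈ S := by
  have hs : Finset.univ.val.map b =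
      2 * x ^ 2 ::ₘ 2 * y ^ 2 ::ₘ (x + y) ^ 2 ::ₘ (x - y) ^ 2 ::ₘ 0 := by subst hb; rfl
  have e0 : (Finset.univ.val.map b).esymm 0 ∈ S := by rw [esymm_zero_right]; exact one_mem S
  have e1 : (Finset.univ.val.map b).esymm 1 ∈ S := by rwa [esymm_one_eq_sum]
  have e2 : (Finset.univ.val.map b).esymm 2 ∈ S := by
    apply mem_of_ofNat_mul_mem S 16
    -- Here e_1 = 4(x² + y²), and the invariants e_2 and e_3, of degrees 4 and 6, are multiples of
    -- its powers.
    have : 16 * (Finset.univ.val.map b).esymm 2 = 5 * (Finset.univ.val.map b).esymm 1 ^ 2 := by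
      simp only [hs, esymm_cons_cons, esymm_cons_cons_one, esymm_zero_right, esymm_empty_succ,
        Nat.reduceAdd]
      ring
    rw [this]
    exact mul_mem (ofNat_mem S 5) (pow_mem e1 2)
  have e3 : (Finset.univ.val.map b).esymm 3 ∈ S := by
    apply mem_of_ofNat_mul_mem S 32
    have : 32 * (Finset.univ.val.map b).esymm 3 = (Finset.univ.val.map b).esymm 1 ^ 3 := by
      simp only [hs, esymm_cons_cons, esymm_cons_cons_one, esymm_zero_right, esymm_empty_succ,
        Nat.reduceAdd]
      ring
    rw [this]
    exact pow_mem e1 3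
  match j with
  | 0 => exact e0
  | 1 => exact e1
  | 2 => exact e2
  | 3 => exact e3
  | 4 => exact esymm_mem_of_sum_pow_mem S b 4 (by norm_num) (fun j hj => by
      interval_cases j <;> assumption) h4
  | j + 5 => rw [esymm_eq_zero_of_card_lt _ (by simp)]; exact zero_mem S

end SymmetricFunctions

/-- The lines of `G_I`. -/
noncomputable def linesI (s : ℂ) : Fin 4 → Fin 2 → ℂ :=
  ![![1, 0], ![0, 1], ![s, s], ![s, -s]]

theorem isLineOrbit_groupI :
    IsLineOrbit groupI 2 (linesI ((Real.sqrt 2 : ℝ) : ℂ)⁻¹) 0 := by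
  have hs := inv_sqrt_ofNat_sq 2
  have hH : hadamard2 ∈ groupI := Subgroup.subset_closure (by simp)
  have hD : diagOne (-1) (by norm_num) ∈ groupI := Subgroup.subset_closure (by simp)
  have hvH := vecMul_hadamard2
  have hvD := vecMul_diagOne (-1) (by norm_num)
  -- Only 2s² = 1 is used from here on.
  generalize ((Real.sqrt 2 : ℝ) : ℂ)⁻¹ = s at *
  refine ⟨rfl, ⟨1, by simp [linesI]⟩, exists_perm_of_closure two_pos ?_, fun i => ?_, ?_⟩
  · rintro σ (rfl | rfl)
    · refine ⟨⟨![2, 3, 0, 1], ![2, 3, 0, 1], by decide, by decide⟩, fun i => ⟨1, one_pow _, ?_⟩⟩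
      rw [hvH]
      ext j
      fin_cases i <;> fin_cases j <;> simp [linesI] <;> grind
    · refine ⟨⟨![0, 1, 3, 2], ![0, 1, 3, 2], by decide, by decide⟩,
        fun i => ⟨(![1, -1, 1, 1] : Fin 4 → ℂ) i, by fin_cases i <;> simp, ?_⟩⟩
      rw [hvD]
      ext j
      fin_cases i <;> fin_cases j <;> simp [linesI]
  · refine ⟨(![1, hadamard2 * diagOne (-1) (by norm_num) * hadamard2, hadamard2,
      hadamard2 * diagOne (-1) (by norm_num)] : Fin 4 → GL (Fin 2) ℂ) i, ?_, 1, one_pow _, ?_⟩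
    · fin_cases i
      exacts [one_mem _, mul_mem (mul_mem hH hD) hH, hH, mul_mem hH hD]
    · ext j
      fin_cases i <;> fin_cases j <;> simp [linesI, ← vecMul_vecMul, hvH, hvD] <;> grind
  -- With H, D the generators, HD is a rotation by π/4, so (HD)⁴ = -1 and (HD)³H = -D sends (1, 0)
  -- to -(1, 0).
  · refine ⟨hadamard2 * diagOne (-1) (by norm_num) * hadamard2 * diagOne (-1) (by norm_num) *
      hadamard2 * diagOne (-1) (by norm_num) * hadamard2,
      mul_mem (mul_mem (mul_mem (mul_mem (mul_mem (mul_mem hH hD) hH) hD) hH) hD) hH, -1,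
      IsPrimitiveRoot.neg_one 0 (by norm_num), ?_⟩
    ext j
    fin_cases j <;> simp [linesI, ← vecMul_vecMul, hvH, hvD] <;> grind

theorem ePolyRing_groupI : Finite groupI ∧ EPolyRingIsPolynomialRing groupI 2 8 := by
  -- κ = s⁻² = 2 clears the denominators of the squared lines.
  refine isLineOrbit_groupI.ePolyRingIsPolynomialRing two_pos 4 2 two_ne_zero
    ![2 * X 0 ^ 2, 2 * X 1 ^ 2, (X 0 + X 1) ^ 2, (X 0 - X 1) ^ 2] (fun i => ?_)
    fun S h1 h4 j => esymm_mem_groupI S (X 0) (X 1) _ rfl h1 h4 j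
  have hs := congrArg (C (σ := Fin 2)) (inv_sqrt_ofNat_sq 2)
  rw [map_mul, map_pow, map_one, map_ofNat] at hs
  have hκ : (C 2 : MvPolynomial (Fin 2) ℂ) = 2 := map_ofNat C 2
  generalize ((Real.sqrt 2 : ℝ) : ℂ)⁻¹ = s at *
  fin_cases i <;> simp [linForm, linesI, hκ] <;> grind

/-! ### The group G_II -/

section SymmetricFunctions

variable {A : Type*} [CommRing A] [Algebra ℂ A] (S : Subalgebra ℂ A)

/-- The eighth powers of the lines of `G_II`. -/
theorem esymm_mem_groupII (x y u : A) (hu : u ^ 2 = -y ^ 2) (b : Fin 6 → A)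
    (hb : b = ![16 * x ^ 8, 16 * y ^ 8, (x + y) ^ 8, (x - y) ^ 8, (x + u) ^ 8, (x - u) ^ 8])
    (h1 : ∑ i, b i ∈ S) (h3 : ∑ i, b i ^ 3 ∈ S) (j : ℕ) :
    (Finset.univ.val.map b).esymm j ∈ S := by
  have hs : Finset.univ.val.map b = 16 * x ^ 8 ::ₘ 16 * y ^ 8 ::ₘ (x + y) ^ 8 ::ₘ (x - y) ^ 8 ::ₘ
      (x + u) ^ 8 ::ₘ (x - u) ^ 8 ::ₘ 0 := by subst hb; rfl
  -- Only z² enters the sum and the product, so u = iy can be eliminated through u² = -y².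
  have hadd : ∀ z : A, (x + z) ^ 8 + (x - z) ^ 8 = 2 * (x ^ 8 + 28 * x ^ 6 * z ^ 2 +
      70 * x ^ 4 * (z ^ 2) ^ 2 + 28 * x ^ 2 * (z ^ 2) ^ 3 + (z ^ 2) ^ 4) := fun z => by ring
  have hmul : ∀ z : A, (x + z) ^ 8 * (x - z) ^ 8 = (x ^ 2 - z ^ 2) ^ 8 := fun z => by
    rw [← mul_pow]; ring
  have e0 : (Finset.univ.val.map b).esymm 0 ∈ S := by rw [esymm_zero_right]; exact one_mem S
  have e1 : (Finset.univ.val.map b).esymm 1 ∈ S := by rwa [esymm_one_eq_sum]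
  have e2 : (Finset.univ.val.map b).esymm 2 ∈ S := by
    apply mem_of_ofNat_mul_mem S 40
    have : 40 * (Finset.univ.val.map b).esymm 2 = 7 * (Finset.univ.val.map b).esymm 1 ^ 2 := by
      simp only [hs, esymm_cons_cons, esymm_cons_cons_one, esymm_zero_right, esymm_empty_succ,
        Nat.reduceAdd, hadd, hmul, hu]
      ring
    rw [this]
    exact mul_mem (ofNat_mem S 7) (pow_mem e1 2)
  have e3 : (Finset.univ.val.map b).esymm 3 ∈ S :=
    esymm_mem_of_sum_pow_mem S b 3 (by norm_num) (fun j hj => by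
      interval_cases j <;> assumption) h3
  have e4 : (Finset.univ.val.map b).esymm 4 ∈ S := by
    apply mem_of_ofNat_mul_mem S 43232000
    -- An invariant of degree 32, sought as a combination of e_1⁴ and e_1e_3; likewise e_5, of
    -- degree 40, from e_1⁵ and e_1²e_3.
    have : 43232000 * (Finset.univ.val.map b).esymm 4 =
        28163 * (Finset.univ.val.map b).esymm 1 ^ 4 -
          848000 * ((Finset.univ.val.map b).esymm 1 * (Finset.univ.val.map b).esymm 3) := by
      simp only [hs, esymm_cons_cons, esymm_cons_cons_one, esymm_zero_right, esymm_empty_succ,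
        Nat.reduceAdd, hadd, hmul, hu]
      ring
    rw [this]
    exact sub_mem (mul_mem (ofNat_mem S _) (pow_mem e1 4))
      (mul_mem (ofNat_mem S _) (mul_mem e1 e3))
  have e5 : (Finset.univ.val.map b).esymm 5 ∈ S := by
    apply mem_of_ofNat_mul_mem S 1080800000
    have : 1080800000 * (Finset.univ.val.map b).esymm 5 =
        4429 * (Finset.univ.val.map b).esymm 1 ^ 5 +
          78000 * ((Finset.univ.val.map b).esymm 1 ^ 2 * (Finset.univ.val.map b).esymm 3) := by
      simp only [hs, esymm_cons_cons, esymm_cons_cons_one, esymm_zero_right, esymm_empty_succ,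
        Nat.reduceAdd, hadd, hmul, hu]
      ring
    rw [this]
    exact add_mem (mul_mem (ofNat_mem S _) (pow_mem e1 5))
      (mul_mem (ofNat_mem S _) (mul_mem (pow_mem e1 2) e3))
  have e6 : (Finset.univ.val.map b).esymm 6 ∈ S := by
    apply mem_of_ofNat_mul_mem S 46725145600
    -- The product of the b_i is 256 (xy(x⁴ - y⁴))⁸, and e_1³ - 80e_3 is a constant multiple of
    -- (xy(x⁴ - y⁴))⁴.
    have : 46725145600 * (Finset.univ.val.map b).esymm 6 =
        ((Finset.univ.val.map b).esymm 1 ^ 3 - 80 * (Finset.univ.val.map b).esymm 3) ^ 2 := by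
      simp only [hs, esymm_cons_cons, esymm_cons_cons_one, esymm_zero_right, esymm_empty_succ,
        Nat.reduceAdd, hadd, hmul, hu]
      ring
    rw [this]
    exact pow_mem (sub_mem (pow_mem e1 3) (mul_mem (ofNat_mem S _) e3)) 2
  match j with
  | 0 => exact e0
  | 1 => exact e1
  | 2 => exact e2
  | 3 => exact e3
  | 4 => exact e4
  | 5 => exact e5
  | 6 => exact e6
  | j + 7 => rw [esymm_eq_zero_of_card_lt _ (by simp)]; exact zero_mem S

end SymmetricFunctions

/-- The lines of `G_II`, for `s = 1 / √2` and `w = i`. -/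
noncomputable def linesII (s w : ℂ) : Fin 6 → Fin 2 → ℂ :=
  ![![1, 0], ![0, 1], ![s, s], ![s, -s], ![s, w * s], ![s, -(w * s)]]

theorem isLineOrbit_closure_hadamard2 (w : ℂ) (hw0 : w ≠ 0) (hw : w ^ 2 = -1) :
    IsLineOrbit (Subgroup.closure {hadamard2, diagOne w hw0}) 8
      (linesII ((Real.sqrt 2 : ℝ) : ℂ)⁻¹ w) 0 := by
  have hs := inv_sqrt_ofNat_sq 2
  have hH : hadamard2 ∈ Subgroup.closure {hadamard2, diagOne w hw0} :=
    Subgroup.subset_closure (by simp)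
  have hD : diagOne w hw0 ∈ Subgroup.closure {hadamard2, diagOne w hw0} :=
    Subgroup.subset_closure (by simp)
  have hvH := vecMul_hadamard2
  have hvD := vecMul_diagOne w hw0
  generalize ((Real.sqrt 2 : ℝ) : ℂ)⁻¹ = s at *
  -- s(1 + w) is a square root of w = ±i, hence a primitive 8th root of unity: this is why d = 8.
  have hζ : (s * (1 + w)) ^ 4 = -1 := by
    have : (s * (1 + w)) ^ 2 = w := by linear_combination s ^ 2 * hw + w * hs
    rw [show 4 = 2 * 2 from rfl, pow_mul, this, hw]
  have hζ' : (s * (1 - w)) ^ 4 = -1 := by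
    have : (s * (1 - w)) ^ 2 = -w := by linear_combination s ^ 2 * hw - w * hs
    rw [show 4 = 2 * 2 from rfl, pow_mul, this, neg_sq, hw]
  have hw8 : w ^ 8 = 1 := by rw [show 8 = 2 * 4 from rfl, pow_mul, hw]; norm_num
  refine ⟨rfl, ⟨1, by simp [linesII]⟩, exists_perm_of_closure (by norm_num) ?_, fun i => ?_, ?_⟩
  · rintro σ (rfl | rfl)
    · refine ⟨⟨![2, 3, 0, 1, 5, 4], ![2, 3, 0, 1, 5, 4], by decide, by decide⟩,
        fun i => ⟨(![1, 1, 1, 1, s * (1 + w), s * (1 - w)] : Fin 6 → ℂ) i, ?_, ?_⟩⟩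
      · fin_cases i
        · simp
        · simp
        · simp
        · simp
        · change (s * (1 + w)) ^ (4 * 2) = 1
          rw [pow_mul, hζ]; norm_num
        · change (s * (1 - w)) ^ (4 * 2) = 1
          rw [pow_mul, hζ']; norm_num
      · rw [hvH]
        ext j
        fin_cases i <;> fin_cases j <;> simp [linesII] <;> grind
    · refine ⟨⟨![0, 1, 4, 5, 3, 2], ![0, 1, 5, 4, 2, 3], by decide, by decide⟩,
        fun i => ⟨(![1, w, 1, 1, 1, 1] : Fin 6 → ℂ) i, by fin_cases i <;> simp [hw8], ?_⟩⟩
      rw [hvD]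
      ext j
      fin_cases i <;> fin_cases j <;> simp [linesII] <;> grind
  · refine ⟨(![1, hadamard2 * diagOne w hw0 * diagOne w hw0 * hadamard2, hadamard2,
      hadamard2 * diagOne w hw0 * diagOne w hw0, hadamard2 * diagOne w hw0,
      hadamard2 * diagOne w hw0 * diagOne w hw0 * diagOne w hw0] : Fin 6 → GL (Fin 2) ℂ) i,
      ?_, 1, one_pow _, ?_⟩
    · fin_cases i
      exacts [one_mem _, mul_mem (mul_mem (mul_mem hH hD) hD) hH, hH, mul_mem (mul_mem hH hD) hD,
        mul_mem hH hD, mul_mem (mul_mem (mul_mem hH hD) hD) hD]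
    · ext j
      fin_cases i <;> fin_cases j <;> simp [linesII, ← vecMul_vecMul, hvH, hvD] <;> grind
  -- (HD)³ is the scalar s(1 + w), so HDHDH = s(1 + w)D⁻¹, and D fixes (1, 0).
  · refine ⟨hadamard2 * diagOne w hw0 * hadamard2 * diagOne w hw0 * hadamard2,
      mul_mem (mul_mem (mul_mem (mul_mem hH hD) hH) hD) hH, s * (1 + w),
      isPrimitiveRoot_two_pow_of_pow_eq_neg_one (n := 2) hζ, ?_⟩
    ext j
    fin_cases j <;> simp [linesII, ← vecMul_vecMul, hvH, hvD] <;> grind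

theorem ePolyRing_groupII : Finite groupII ∧ EPolyRingIsPolynomialRing groupII 8 24 := by
  have hw := Complex.I_sq
  have hs := congrArg (C (σ := Fin 2)) (inv_sqrt_ofNat_sq 2)
  have key : IsLineOrbit groupII 8 (linesII ((Real.sqrt 2 : ℝ) : ℂ)⁻¹ Complex.I) 0 :=
    isLineOrbit_closure_hadamard2 _ Complex.I_ne_zero hw
  generalize ((Real.sqrt 2 : ℝ) : ℂ)⁻¹ = s at *
  generalize Complex.I = w at *
  have hw' := congrArg (C (σ := Fin 2)) hw
  rw [map_pow, map_neg, map_one] at hw'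
  refine key.ePolyRingIsPolynomialRing (by norm_num) 3 16 (by norm_num)
    ![16 * X 0 ^ 8, 16 * X 1 ^ 8, (X 0 + X 1) ^ 8, (X 0 - X 1) ^ 8, (X 0 + C w * X 1) ^ 8,
      (X 0 - C w * X 1) ^ 8]
    (fun i => ?_)
    fun S h1 h3 j => esymm_mem_groupII S (X 0) (X 1) (C w * X 1)
      (by rw [mul_pow, hw', neg_one_mul]) _ rfl h1 h3 j
  have hκ : (C 16 : MvPolynomial (Fin 2) ℂ) = 16 := map_ofNat C 16
  rw [map_mul, map_pow, map_one, map_ofNat] at hs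
  have hs8 : 16 * (C s : MvPolynomial (Fin 2) ℂ) ^ 8 = 1 := by
    linear_combination (8 * C s ^ 6 + 4 * C s ^ 4 + 2 * C s ^ 2 + 1) * hs
  fin_cases i <;> simp [linForm, linesII, hκ]
  · linear_combination -(X 0 + X 1) ^ 8 * hs8
  · linear_combination -(X 0 - X 1) ^ 8 * hs8
  · linear_combination -(X 0 + C w * X 1) ^ 8 * hs8
  · linear_combination -(X 0 - C w * X 1) ^ 8 * hs8

/-! ### The group G_III -/

section SymmetricFunctions

variable {A : Type*} [CommRing A] [Algebra ℂ A] (S : Subalgebra ℂ A)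

/-- The fourth powers of the lines of `G_III`. -/
theorem esymm_mem_groupIII (x y w : A) (hw : w ^ 2 + w + 1 = 0) (b : Fin 4 → A)
    (hb : b = ![9 * x ^ 4, (x + 2 * y) ^ 4, (x + 2 * w * y) ^ 4, (x + 2 * w ^ 2 * y) ^ 4])
    (h1 : ∑ i, b i ∈ S) (h3 : ∑ i, b i ^ 3 ∈ S) (j : ℕ) :
    (Finset.univ.val.map b).esymm j ∈ S := by
  have hs : Finset.univ.val.map b = 9 * x ^ 4 ::ₘ (x + 2 * y) ^ 4 ::ₘ
      (x + 2 * w * y) ^ 4 ::ₘ (x + 2 * w ^ 2 * y) ^ 4 ::ₘ 0 := by subst hb; rfl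
  -- The two lines involving w are conjugate: the symmetric functions of the pair lose w.
  have hadd : (x + 2 * w * y) + (x + 2 * w ^ 2 * y) = 2 * x - 2 * y := by
    linear_combination 2 * y * hw
  have hmul : (x + 2 * w * y) * (x + 2 * w ^ 2 * y) = x ^ 2 - 2 * x * y + 4 * y ^ 2 := by
    linear_combination (2 * x * y + 4 * y ^ 2 * (w - 1)) * hw
  have hadd4 : (x + 2 * w * y) ^ 4 + (x + 2 * w ^ 2 * y) ^ 4 =
      (2 * x - 2 * y) ^ 4 - 4 * (2 * x - 2 * y) ^ 2 * (x ^ 2 - 2 * x * y + 4 * y ^ 2) +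
        2 * (x ^ 2 - 2 * x * y + 4 * y ^ 2) ^ 2 := by
    rw [← hadd, ← hmul]; ring
  have hmul4 : (x + 2 * w * y) ^ 4 * (x + 2 * w ^ 2 * y) ^ 4 =
      (x ^ 2 - 2 * x * y + 4 * y ^ 2) ^ 4 := by
    rw [← hmul, mul_pow]
  have e0 : (Finset.univ.val.map b).esymm 0 ∈ S := by rw [esymm_zero_right]; exact one_mem S
  have e1 : (Finset.univ.val.map b).esymm 1 ∈ S := by rwa [esymm_one_eq_sum]
  have e2 : (Finset.univ.val.map b).esymm 2 ∈ S := by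
    apply mem_of_ofNat_mul_mem S 24
    have : 24 * (Finset.univ.val.map b).esymm 2 = 5 * (Finset.univ.val.map b).esymm 1 ^ 2 := by
      simp only [hs, esymm_cons_cons, esymm_cons_cons_one, esymm_zero_right, esymm_empty_succ,
        Nat.reduceAdd, hadd4, hmul4]
      ring
    rw [this]
    exact mul_mem (ofNat_mem S 5) (pow_mem e1 2)
  have e3 : (Finset.univ.val.map b).esymm 3 ∈ S :=
    esymm_mem_of_sum_pow_mem S b 3 (by norm_num) (fun j hj => by
      interval_cases j <;> assumption) h3
  have e4 : (Finset.univ.val.map b).esymm 4 ∈ S := by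
    apply mem_of_ofNat_mul_mem S 2304
    -- e_1 = 12x(x³ + 8y³) is 12 times a product of the lines, whence e_4 = 9(x(x³ + 8y³))⁴ is a
    -- multiple of e_1⁴.
    have : 2304 * (Finset.univ.val.map b).esymm 4 = (Finset.univ.val.map b).esymm 1 ^ 4 := by
      simp only [hs, esymm_cons_cons, esymm_cons_cons_one, esymm_zero_right, esymm_empty_succ,
        Nat.reduceAdd, hadd4, hmul4]
      ring
    rw [this]
    exact pow_mem e1 4
  match j with
  | 0 => exact e0
  | 1 => exact e1
  | 2 => exact e2
  | 3 => exact e3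
  | 4 => exact e4
  | j + 5 => rw [esymm_eq_zero_of_card_lt _ (by simp)]; exact zero_mem S

end SymmetricFunctions

/-- The lines of `G_III`, for `s = 1 / √3` and a primitive cube root of unity `w`. -/
noncomputable def linesIII (s w : ℂ) : Fin 4 → Fin 2 → ℂ :=
  ![![1, 0], ![s, 2 * s], ![s, 2 * w * s], ![s, 2 * w ^ 2 * s]]

theorem exp_two_pi_I_div_three :
    Complex.exp (2 * Real.pi * Complex.I / 3) ^ 2 + Complex.exp (2 * Real.pi * Complex.I / 3) + 1
      = 0 := by
  have h := (Complex.isPrimitiveRoot_exp 3 (by norm_num)).geom_sum_eq_zero (by norm_num)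
  simp only [Finset.sum_range_succ, Finset.sum_range_zero] at h
  push_cast at h
  linear_combination h

theorem isLineOrbit_closure_hadamard3 (w : ℂ) (hw0 : w ≠ 0) (hw : w ^ 2 + w + 1 = 0) :
    IsLineOrbit (Subgroup.closure {hadamard3, diagOne w hw0}) 4
      (linesIII ((Real.sqrt 3 : ℝ) : ℂ)⁻¹ w) 0 := by
  have hs := inv_sqrt_ofNat_sq 3
  have hH : hadamard3 ∈ Subgroup.closure {hadamard3, diagOne w hw0} :=
    Subgroup.subset_closure (by simp)
  have hD : diagOne w hw0 ∈ Subgroup.closure {hadamard3, diagOne w hw0} :=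
    Subgroup.subset_closure (by simp)
  have hvH := vecMul_hadamard3
  have hvD := vecMul_diagOne w hw0
  generalize ((Real.sqrt 3 : ℝ) : ℂ)⁻¹ = s at *
  have hs0 : s ≠ 0 := by rintro rfl; norm_num at hs
  have hζ : (s * (1 + 2 * w)) ^ 2 = -1 := by
    linear_combination 4 * s ^ 2 * hw - hs
  have hζ' : (s * (1 + 2 * w ^ 2)) ^ 2 = -1 := by
    linear_combination 4 * s ^ 2 * (w ^ 2 - w + 1) * hw - hs
  refine ⟨rfl, ⟨1, by simp [linesIII, hs0]⟩, exists_perm_of_closure four_pos ?_, fun i => ?_, ?_⟩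
  · rintro σ (rfl | rfl)
    · refine ⟨⟨![1, 0, 3, 2], ![1, 0, 3, 2], by decide, by decide⟩,
        fun i => ⟨(![1, 1, s * (1 + 2 * w), s * (1 + 2 * w ^ 2)] : Fin 4 → ℂ) i, ?_, ?_⟩⟩
      · fin_cases i
        · simp
        · simp
        · change (s * (1 + 2 * w)) ^ (2 * 2) = 1
          rw [pow_mul, hζ]; norm_num
        · change (s * (1 + 2 * w ^ 2)) ^ (2 * 2) = 1
          rw [pow_mul, hζ']; norm_num
      · rw [hvH]
        ext j
        fin_cases i <;> fin_cases j <;> simp [linesIII] <;> grind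
    · refine ⟨⟨![0, 2, 3, 1], ![0, 3, 1, 2], by decide, by decide⟩, fun i => ⟨1, one_pow _, ?_⟩⟩
      rw [hvD]
      ext j
      fin_cases i <;> fin_cases j <;> simp [linesIII] <;> grind
  · refine ⟨(![1, hadamard3, hadamard3 * diagOne w hw0, hadamard3 * diagOne w hw0 * diagOne w hw0] :
      Fin 4 → GL (Fin 2) ℂ) i, ?_, 1, one_pow _, ?_⟩
    · fin_cases i
      exacts [one_mem _, hH, mul_mem hH hD, mul_mem (mul_mem hH hD) hD]
    · ext j
      fin_cases i <;> fin_cases j <;> simp [linesIII, ← vecMul_vecMul, hvH, hvD] <;> grind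
  -- (HD)³ is the scalar s(1 + 2w), a square root of -1, so HDHDH = s(1 + 2w)D⁻¹.
  · refine ⟨hadamard3 * diagOne w hw0 * hadamard3 * diagOne w hw0 * hadamard3,
      mul_mem (mul_mem (mul_mem (mul_mem hH hD) hH) hD) hH, s * (1 + 2 * w),
      isPrimitiveRoot_two_pow_of_pow_eq_neg_one (n := 1) (by rw [pow_one, hζ]), ?_⟩
    ext j
    fin_cases j <;> simp [linesIII, ← vecMul_vecMul, hvH, hvD] <;> grind

theorem ePolyRing_groupIII : Finite groupIII ∧ EPolyRingIsPolynomialRing groupIII 4 12 := by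
  have hw := exp_two_pi_I_div_three
  have hs := congrArg (C (σ := Fin 2)) (inv_sqrt_ofNat_sq 3)
  have key : IsLineOrbit groupIII 4 (linesIII ((Real.sqrt 3 : ℝ) : ℂ)⁻¹
      (Complex.exp (2 * Real.pi * Complex.I / 3))) 0 :=
    isLineOrbit_closure_hadamard3 _ (Complex.exp_ne_zero _) hw
  generalize ((Real.sqrt 3 : ℝ) : ℂ)⁻¹ = s at *
  generalize Complex.exp (2 * Real.pi * Complex.I / 3) = w at *
  have hw' := congrArg (C (σ := Fin 2)) hw
  rw [map_add, map_add, map_pow, map_one, map_zero] at hw'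
  refine key.ePolyRingIsPolynomialRing four_pos 3 9 (by norm_num)
    ![9 * X 0 ^ 4, (X 0 + 2 * X 1) ^ 4, (X 0 + 2 * C w * X 1) ^ 4, (X 0 + 2 * C w ^ 2 * X 1) ^ 4]
    (fun i => ?_)
    fun S h1 h3 j => esymm_mem_groupIII S (X 0) (X 1) (C w) hw' _ rfl h1 h3 j
  have h2 : (C 2 : MvPolynomial (Fin 2) ℂ) = 2 := map_ofNat C 2
  have hκ : (C 9 : MvPolynomial (Fin 2) ℂ) = 9 := map_ofNat C 9
  rw [map_mul, map_pow, map_one, map_ofNat] at hs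
  have hs4 : 9 * (C s : MvPolynomial (Fin 2) ℂ) ^ 4 = 1 := by
    linear_combination (3 * C s ^ 2 + 1) * hs
  fin_cases i <;> simp [linForm, linesIII, hκ, h2]
  · linear_combination -(X 0 + 2 * X 1) ^ 4 * hs4
  · linear_combination -(X 0 + 2 * C w * X 1) ^ 4 * hs4
  · linear_combination -(X 0 + 2 * C w ^ 2 * X 1) ^ 4 * hs4

/-! ### The group G_IV -/

section SymmetricFunctions

variable {A : Type*} [CommRing A] [Algebra ℂ A] (S : Subalgebra ℂ A)

/-- The squares of the lines of `G_IV`. -/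
theorem esymm_mem_groupIV (x y : A) (b : Fin 3 → A)
    (hb : b = ![4 * x ^ 2, (x + 3 * y) ^ 2, (x - 3 * y) ^ 2])
    (h1 : ∑ i, b i ∈ S) (h3 : ∑ i, b i ^ 3 ∈ S) (j : ℕ) :
    (Finset.univ.val.map b).esymm j ∈ S := by
  have hs : Finset.univ.val.map b =
      4 * x ^ 2 ::ₘ (x + 3 * y) ^ 2 ::ₘ (x - 3 * y) ^ 2 ::ₘ 0 := by subst hb; rfl
  have e0 : (Finset.univ.val.map b).esymm 0 ∈ S := by rw [esymm_zero_right]; exact one_mem S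
  have e1 : (Finset.univ.val.map b).esymm 1 ∈ S := by rwa [esymm_one_eq_sum]
  have e2 : (Finset.univ.val.map b).esymm 2 ∈ S := by
    apply mem_of_ofNat_mul_mem S 4
    have : 4 * (Finset.univ.val.map b).esymm 2 = (Finset.univ.val.map b).esymm 1 ^ 2 := by
      simp only [hs, esymm_cons_cons, esymm_cons_cons_one, esymm_zero_right, esymm_singleton_one,
        esymm_singleton_two, Nat.reduceAdd]
      ring
    rw [this]
    exact pow_mem e1 2
  match j with
  | 0 => exact e0
  | 1 => exact e1
  | 2 => exact e2
  | 3 => exact esymm_mem_of_sum_pow_mem S b 3 (by norm_num) (fun j hj => by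
      interval_cases j <;> assumption) h3
  | j + 4 => rw [esymm_eq_zero_of_card_lt _ (by simp)]; exact zero_mem S

end SymmetricFunctions

/-- The lines of `G_IV`. -/
noncomputable def linesIV : Fin 3 → Fin 2 → ℂ :=
  ![![1, 0], ![2⁻¹, 3 * 2⁻¹], ![2⁻¹, -(3 * 2⁻¹)]]

theorem isLineOrbit_groupIV : IsLineOrbit groupIV 2 linesIV 0 := by
  have hH : hadamard4 ∈ groupIV := Subgroup.subset_closure (by simp)
  have hD : diagOne (-1) (by norm_num) ∈ groupIV := Subgroup.subset_closure (by simp)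
  have hvH := vecMul_hadamard4
  have hvD := vecMul_diagOne (-1) (by norm_num)
  refine ⟨rfl, ⟨1, by simp [linesIV]⟩, exists_perm_of_closure two_pos ?_, fun i => ?_, ?_⟩
  · rintro σ (rfl | rfl)
    · refine ⟨⟨![1, 0, 2], ![1, 0, 2], by decide, by decide⟩,
        fun i => ⟨(![1, 1, -1] : Fin 3 → ℂ) i, by fin_cases i <;> simp, ?_⟩⟩
      rw [hvH]
      ext j
      fin_cases i <;> fin_cases j <;> simp [linesIV] <;> norm_num
    · refine ⟨⟨![0, 2, 1], ![0, 2, 1], by decide, by decide⟩, fun i => ⟨1, one_pow _, ?_⟩⟩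
      rw [hvD]
      ext j
      fin_cases i <;> fin_cases j <;> simp [linesIV]
  · refine ⟨(![1, hadamard4, hadamard4 * diagOne (-1) (by norm_num)] : Fin 3 → GL (Fin 2) ℂ) i,
      ?_, 1, one_pow _, ?_⟩
    · fin_cases i
      exacts [one_mem _, hH, mul_mem hH hD]
    · ext j
      fin_cases i <;> fin_cases j <;> simp [linesIV, ← vecMul_vecMul, hvH, hvD] <;> norm_num
  -- HD has trace 1 and determinant 1, so (HD)³ = -1 and HDHDH = -D.
  · refine ⟨hadamard4 * diagOne (-1) (by norm_num) * hadamard4 * diagOne (-1) (by norm_num) *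
      hadamard4, mul_mem (mul_mem (mul_mem (mul_mem hH hD) hH) hD) hH, -1,
      IsPrimitiveRoot.neg_one 0 (by norm_num), ?_⟩
    ext j
    fin_cases j <;> simp [linesIV, ← vecMul_vecMul, hvH, hvD] <;> norm_num

theorem ePolyRing_groupIV : Finite groupIV ∧ EPolyRingIsPolynomialRing groupIV 2 6 := by
  refine isLineOrbit_groupIV.ePolyRingIsPolynomialRing two_pos 3 4 (by norm_num)
    ![4 * X 0 ^ 2, (X 0 + 3 * X 1) ^ 2, (X 0 - 3 * X 1) ^ 2] (fun i => ?_)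
    fun S h1 h3 j => esymm_mem_groupIV S (X 0) (X 1) _ rfl h1 h3 j
  have hs := congrArg (C (σ := Fin 2)) (mul_inv_cancel₀ (two_ne_zero (α := ℂ)))
  have h3 : (C 3 : MvPolynomial (Fin 2) ℂ) = 3 := map_ofNat C 3
  have hκ : (C 4 : MvPolynomial (Fin 2) ℂ) = 4 := map_ofNat C 4
  rw [map_mul, map_one, map_ofNat] at hs
  fin_cases i <;> simp [linForm, linesIV, hκ, h3] <;> grind

end EPoly

theorem mainTheorem3 :
    (Finite EPoly.groupI ∧ EPoly.EPolyRingIsPolynomialRing EPoly.groupI 2 8) ∧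
    (Finite EPoly.groupII ∧ EPoly.EPolyRingIsPolynomialRing EPoly.groupII 8 24) ∧
    (Finite EPoly.groupIII ∧ EPoly.EPolyRingIsPolynomialRing EPoly.groupIII 4 12) ∧
    (Finite EPoly.groupIV ∧ EPoly.EPolyRingIsPolynomialRing EPoly.groupIV 2 6) :=
  ⟨EPoly.ePolyRing_groupI, EPoly.ePolyRing_groupII, EPoly.ePolyRing_groupIII,
    EPoly.ePolyRing_groupIV⟩
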